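/- Let $\mu$ be a nontrivial (i.e. with infinite support) finite positive Borel measure on the unit circle $\mathbb T$, let $\Phi_n$ be its monic orthogonal polynomials and $\alpha_n=-\overline{\Phi_{n+1}(0)}$, $n\ge 0$, its Verblunsky coefficients. Put $\tau_0=1$, $\tau_n=\dfrac{\tau_{n-1}-\overline{\alpha}_{n-1}}{1-\tau_{n-1}\alpha_{n-1}}$ for $n\ge1$, and for $n\ge1$ $$c_n=\frac{-\operatorname{Im}(\tau_{n-1}\alpha_{n-1})}{1-\operatorname{Re}(\tau_{n-1}\alpha_{n-1})},\qquad g_n=\frac12\,\frac{|1-\tau_{n-1}\alpha_{n-1}|^2}{1-\operatorname{Re}(\tau_{n-1}\alpha_{n-1})},\qquad d_{n+1}=(1-g_n)g_{n+1}.$$ A real sequence $\{e_{n+1}\}_{n\ge1}$ is called a positive chain sequence if there are $0\le h_1<1$ and $0<h_n<1$ $(n\ge2)$ with $e_{n+1}=(1-h_n)h_{n+1}$ for all $n\ge1$. Let $\{q_{n+1}\}_{n\ge1}$ be a scaling sequence for $\{d_{n+1}\}_{n\ge1}$, i.e. $0<q_{n+1}\le1$ for all $n\ge1$ and $\{d_{n+1}/q_{n+1}\}_{n\ge1}$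 is a positive chain sequence. Put $q^{(1)}_1=q_2$ and $q_n^{(1)}=\max\{q_n,q_{n+1}\}$ for $n\ge2$. Let $0\le\vartheta_1<\vartheta_2\le2\pi$ and suppose that for all $n\ge1$ $$\cot(\vartheta_2/4)\le\frac{c_n+\sqrt{c_n^2+(1-q_n^{(1)})}}{1+\sqrt{q_n^{(1)}}}\qquad\text{and}\qquad \frac{1+\sqrt{q_n^{(1)}}}{-c_n+\sqrt{c_n^2+(1-q_n^{(1)})}}\le\cot(\vartheta_1/4),$$ where the second inequality is read in $[0,+\infty]$: $\cot 0=+\infty$, and the left-hand quotient is $+\infty$ if its denominator is $0$. Let $\mu(0;\cdot)$ be the probability measure obtained from $\mu$ by removing the possible mass point at $z=1$ and normalizing, i.e. $\mu(0;\cdot)=\dfrac{\mu-\mu(\{1\})\delta_1}{\mu(\mathbb T)-\mu(\{1\})}$. Then $$\operatorname{supp}\mu(0;\cdot)\subseteq\{e^{i\theta}:\vartheta_1\le\theta\le\vartheta_2\}.$$ -/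

import Mathlib

open MeasureTheory Polynomial
open scoped ENNReal ComplexConjugate

noncomputable section

/-! ### Orthogonal polynomials on the unit circle -/

/-- The unit circle carries its Borel σ-algebra. -/
instance circleMeasurableSpace : MeasurableSpace Circle := borel Circle

instance circleBorelSpace : BorelSpace Circle := ⟨rfl⟩

/-- The inner product `∫ p(z) conj(q(z)) dμ(z)` on polynomials, for a measure on the unit circle. -/
def opucInner (μ : Measure Circle) (p q : ℂ[X]) : ℂ :=
  ∫ z : Circle, p.eval (z : ℂ) * conj (q.eval (z : ℂ)) ∂μ

/-- The monic orthogonal polynomials `Φ_n` of a measure on the unit circle with infinite support,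
obtained from the monomials by the (unnormalized) Gram-Schmidt process. -/
def monicOPUC (μ : Measure Circle) (n : ℕ) : ℂ[X] :=
  X ^ n - ∑ j : Fin n,
    C (opucInner μ (X ^ n) (monicOPUC μ j) / opucInner μ (monicOPUC μ j) (monicOPUC μ j)) *
      monicOPUC μ j
termination_by n
decreasing_by all_goals exact j.isLt

/-- The Verblunsky coefficients `α_n = - conj (Φ_{n+1}(0))`, `n ≥ 0`. -/
def verblunsky (μ : Measure Circle) (n : ℕ) : ℂ :=
  -conj ((monicOPUC μ (n + 1)).eval 0)

/-! ### The `(c_n, d_n)`-parametrization -/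

/-- `τ_0 = 1`, `τ_n = (τ_{n-1} - conj α_{n-1}) / (1 - τ_{n-1} α_{n-1})` for `n ≥ 1`. -/
def tauSeq (α : ℕ → ℂ) : ℕ → ℂ
  | 0 => 1
  | n + 1 => (tauSeq α n - conj (α n)) / (1 - tauSeq α n * α n)

/-- `c_n = - Im (τ_{n-1} α_{n-1}) / (1 - Re (τ_{n-1} α_{n-1}))`, used for `n ≥ 1`. -/
def cSeq (α : ℕ → ℂ) (n : ℕ) : ℝ :=
  -(tauSeq α (n - 1) * α (n - 1)).im / (1 - (tauSeq α (n - 1) * α (n - 1)).re)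

/-- `g_n = |1 - τ_{n-1} α_{n-1}|² / (2 (1 - Re (τ_{n-1} α_{n-1})))`, used for `n ≥ 1`. -/
def gSeq (α : ℕ → ℂ) (n : ℕ) : ℝ :=
  1 / 2 * (‖1 - tauSeq α (n - 1) * α (n - 1)‖ ^ 2 / (1 - (tauSeq α (n - 1) * α (n - 1)).re))

/-- `d_n = (1 - g_{n-1}) g_n`, used for `n ≥ 2`; that is, `d_{n+1} = (1 - g_n) g_{n+1}` for
`n ≥ 1`. -/
def dSeq (α : ℕ → ℂ) (n : ℕ) : ℝ :=
  (1 - gSeq α (n - 1)) * gSeq α n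

/-! ### Chain sequences and scaling sequences; only the values at `n ≥ 2` of `d`, `q` matter -/

/-- `{d_{n+1}}_{n ≥ 1}` is a positive chain sequence. -/
def IsPositiveChainSeq (d : ℕ → ℝ) : Prop :=
  ∃ g : ℕ → ℝ, (0 ≤ g 1 ∧ g 1 < 1) ∧ (∀ n, 2 ≤ n → 0 < g n ∧ g n < 1) ∧
    ∀ n, 1 ≤ n → d (n + 1) = (1 - g n) * g (n + 1)

/-- `{q_{n+1}}_{n ≥ 1}` is a scaling sequence for `{d_{n+1}}_{n ≥ 1}`. -/
def IsScalingSeq (q d : ℕ → ℝ) : Prop :=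
  (∀ n, 1 ≤ n → 0 < q (n + 1) ∧ q (n + 1) ≤ 1) ∧ IsPositiveChainSeq (fun n => d n / q n)

/-- `q_1^{(1)} = q_2` and `q_n^{(1)} = max (q_n, q_{n+1})` for `n ≥ 2`. -/
def qOne (q : ℕ → ℝ) (n : ℕ) : ℝ :=
  if n = 1 then q 2 else max (q n) (q (n + 1))

/-- `(c + √(c² + (1 - q))) / (1 + √q)`. -/
def lowerExpr (c q : ℝ) : ℝ :=
  (c + √(c ^ 2 + (1 - q))) / (1 + √q)

/-- `(1 + √q) / (-c + √(c² + (1 - q)))` as an element of `[0, ∞]` (for `0 ≤ q ≤ 1`); it is `∞`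
when the denominator vanishes, i.e. when `q = 1` and `c ≥ 0`. -/
def upperExpr (c q : ℝ) : ℝ≥0∞ :=
  ENNReal.ofReal (1 + √q) / ENNReal.ofReal (-c + √(c ^ 2 + (1 - q)))

/-- The cotangent on `[0, π/2]` as a function with values in `[0, ∞]`; `cot 0 = ∞`. -/
def cotENN (φ : ℝ) : ℝ≥0∞ :=
  ENNReal.ofReal (Real.cos φ) / ENNReal.ofReal (Real.sin φ)

/-! ### The family `μ(t; ·)` and arcs -/

/-- The probability measure `μ(t; ·)` having mass `t` at `1` and proportional to `μ` off `1`.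
For a probability measure `μ` with `μ({1}) = a` this is
`(1-t)/(1-a) μ + (t-a)/(1-a) δ_1`, see `massFamily_apply`. -/
def massFamily (μ : Measure Circle) (t : ℝ) : Measure Circle :=
  ENNReal.ofReal (1 - t) • ProbabilityTheory.cond μ {1}ᶜ + ENNReal.ofReal t • Measure.dirac 1

/-- The closed arc `{e^{iθ} : ϑ₁ ≤ θ ≤ ϑ₂}`. -/
def closedArc (ϑ₁ ϑ₂ : ℝ) : Set Circle :=
  Circle.exp '' Set.Icc ϑ₁ ϑ₂

/-! ### Consistency of the definitions -/

theorem massFamily_apply (μ : Measure Circle) [IsProbabilityMeasure μ] (h : μ.real {1} < 1)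
    {t : ℝ} (h0 : 0 ≤ t) (h1 : t < 1) {s : Set Circle} (hs : MeasurableSet s) :
    (massFamily μ t).real s = (1 - t) / (1 - μ.real {1}) * μ.real s +
      (t - μ.real {1}) / (1 - μ.real {1}) * (Measure.dirac (1 : Circle)).real s := by
  have hne : (1 : ℝ) - μ.real {1} ≠ 0 := by linarith
  have hc : μ.real ({1}ᶜ : Set Circle) = 1 - μ.real {1} := by
    rw [measureReal_compl (measurableSet_singleton _)]; simp
  have hc0 : μ ({1}ᶜ : Set Circle) ≠ 0 := by
    intro h'
    apply hne
    rw [← hc, measureReal_def, h']; simp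
  have key : (massFamily μ t).real s =
      (1 - t) * ((1 - μ.real {1})⁻¹ * μ.real (s ∩ {1}ᶜ)) +
        t * (Measure.dirac (1 : Circle)).real s := by
    have hfin : (μ ({1}ᶜ : Set Circle))⁻¹ * μ (s ∩ {1}ᶜ) ≠ ∞ :=
      ENNReal.mul_ne_top (ENNReal.inv_ne_top.2 hc0) (measure_ne_top _ _)
    simp only [massFamily, ProbabilityTheory.cond, measureReal_def, Measure.add_apply,
      Measure.smul_apply, smul_eq_mul, Measure.restrict_apply hs]
    rw [ENNReal.toReal_add (ENNReal.mul_ne_top ENNReal.ofReal_ne_top hfin)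
        (ENNReal.mul_ne_top ENNReal.ofReal_ne_top (measure_ne_top _ _)),
      ENNReal.toReal_mul, ENNReal.toReal_mul, ENNReal.toReal_mul, ENNReal.toReal_inv,
      ENNReal.toReal_ofReal h0, ENNReal.toReal_ofReal (by linarith)]
    simp only [← measureReal_def, hc]
  rw [key]
  by_cases h1s : (1 : Circle) ∈ s
  · have e1 : s ∩ {1}ᶜ = s \ {1} := rfl
    have e2 : μ.real (s \ {1}) = μ.real s - μ.real {1} :=
      measureReal_sdiff (by simpa using h1s) (measurableSet_singleton _)
    have e3 : (Measure.dirac (1 : Circle)).real s = 1 := by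
      simp [measureReal_def, Measure.dirac_apply' _ hs, h1s]
    rw [e1, e2, e3]
    field_simp
    ring
  · have e1 : s ∩ {1}ᶜ = s := by
      ext x; simp only [Set.mem_inter_iff, Set.mem_compl_iff, Set.mem_singleton_iff]
      exact ⟨fun hx => hx.1, fun hx => ⟨hx, fun hx1 => h1s (hx1 ▸ hx)⟩⟩
    have e3 : (Measure.dirac (1 : Circle)).real s = 0 := by
      simp [measureReal_def, Measure.dirac_apply' _ hs, h1s]
    rw [e1, e3]
    field_simp
    ring

theorem monicOPUC_monic (μ : Measure Circle) (n : ℕ) :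
    (monicOPUC μ n).Monic ∧ (monicOPUC μ n).natDegree = n := by
  induction n using Nat.strong_induction_on with
  | _ n ih =>
    rw [monicOPUC]
    set S := ∑ j : Fin n,
      C (opucInner μ (X ^ n) (monicOPUC μ j) / opucInner μ (monicOPUC μ j) (monicOPUC μ j)) *
        monicOPUC μ j with hS
    have hdeg : S.degree < (n : WithBot ℕ) := by
      apply (Polynomial.degree_sum_le _ _).trans_lt
      refine (Finset.sup_lt_iff (WithBot.bot_lt_coe n)).2 ?_
      intro j _
      rw [← Polynomial.smul_eq_C_mul]
      refine lt_of_le_of_lt (Polynomial.degree_smul_le _ _) ?_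
      rw [Polynomial.degree_eq_natDegree (ih j j.isLt).1.ne_zero, (ih j j.isLt).2]
      exact Nat.cast_lt.2 j.isLt
    have hd : (X ^ n - S : ℂ[X]).degree = n := by
      rw [Polynomial.degree_sub_eq_left_of_degree_lt] <;> simp [hdeg]
    have hm : (X ^ n - S : ℂ[X]).Monic := by
      refine (Polynomial.monic_X_pow n).sub_of_left ?_
      simpa using hdeg
    exact ⟨hm, Polynomial.natDegree_eq_of_degree_eq_some hd⟩

theorem opucInner_integrable (μ : Measure Circle) [IsFiniteMeasure μ] (p q : ℂ[X]) :
    Integrable (fun z : Circle => p.eval (z : ℂ) * conj (q.eval (z : ℂ))) μ := by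
  have hc : Continuous (fun z : Circle => p.eval (z : ℂ) * conj (q.eval (z : ℂ))) :=
    (p.continuous.comp continuous_subtype_val).mul
      (Complex.continuous_conj.comp (q.continuous.comp continuous_subtype_val))
  exact hc.integrable_of_hasCompactSupport (HasCompactSupport.of_compactSpace _)

theorem opucInner_self_ne_zero (μ : Measure Circle) [IsFiniteMeasure μ]
    (hμ : μ.support.Infinite) {p : ℂ[X]} (hp : p ≠ 0) : opucInner μ p p ≠ 0 := by
  intro h
  have hc : Continuous (fun z : Circle => p.eval (z : ℂ)) :=
    p.continuous.comp continuous_subtype_val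
  have h1 : opucInner μ p p = ((∫ z : Circle, ‖p.eval (z : ℂ)‖ ^ 2 ∂μ : ℝ) : ℂ) := by
    rw [opucInner, ← integral_complex_ofReal]
    congr 1
    ext z
    rw [Complex.mul_conj']
    push_cast
    rfl
  rw [h1, Complex.ofReal_eq_zero] at h
  have hint : Integrable (fun z : Circle => ‖p.eval (z : ℂ)‖ ^ 2) μ :=
    (hc.norm.pow 2).integrable_of_hasCompactSupport (HasCompactSupport.of_compactSpace _)
  replace h := (integral_eq_zero_iff_of_nonneg (fun z => by positivity) hint).1 h
  have hsub : μ.support ⊆ {z : Circle | p.eval (z : ℂ) = 0} := by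
    intro z hz
    by_contra hne
    have hop : IsOpen {z : Circle | p.eval (z : ℂ) ≠ 0} := isOpen_ne_fun hc continuous_const
    have := (Measure.mem_support_iff_forall z).1 hz _ (hop.mem_nhds hne)
    refine this.ne' ?_
    have h' : ∀ᵐ z ∂μ, p.eval ((z : Circle) : ℂ) = 0 := by
      filter_upwards [h] with z hz
      simpa using hz
    exact h'
  refine hμ (Set.Finite.subset ?_ hsub)
  have : {z : Circle | p.eval (z : ℂ) = 0} = (fun z : Circle => (z : ℂ)) ⁻¹' {w | p.IsRoot w} := rfl
  rw [this]
  exact (Polynomial.finite_setOfPred_isRoot hp).preimage Circle.coe_injective.injOn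

theorem opucInner_monicOPUC_of_lt (μ : Measure Circle) [IsFiniteMeasure μ]
    (hμ : μ.support.Infinite) {m n : ℕ} (h : m < n) :
    opucInner μ (monicOPUC μ n) (monicOPUC μ m) = 0 := by
  induction n using Nat.strong_induction_on generalizing m with
  | _ n ih =>
    have hsum : opucInner μ (monicOPUC μ n) (monicOPUC μ m) =
        opucInner μ (X ^ n) (monicOPUC μ m) - ∑ j : Fin n,
          opucInner μ (X ^ n) (monicOPUC μ j) / opucInner μ (monicOPUC μ j) (monicOPUC μ j) *
            opucInner μ (monicOPUC μ j) (monicOPUC μ m) := by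
      conv_lhs => rw [monicOPUC]
      simp only [opucInner]
      simp only [← integral_const_mul]
      rw [← integral_finsetSum _ fun j _ => (opucInner_integrable μ _ _).const_mul _,
        ← integral_sub (opucInner_integrable μ _ _) (integrable_finsetSum _ fun j _ =>
          (opucInner_integrable μ _ _).const_mul _)]
      congr 1
      ext z
      simp only [eval_sub, eval_finsetSum, eval_mul, eval_C, sub_mul, Finset.sum_mul, mul_assoc]
    rw [hsum, Finset.sum_eq_single ⟨m, h⟩]
    · rw [div_mul_cancel₀ _ (opucInner_self_ne_zero μ hμ (monicOPUC_monic μ m).1.ne_zero), sub_self]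
    · intro j _ hj
      have hjm : (j : ℕ) ≠ m := fun e => hj (Fin.ext e)
      rcases lt_or_gt_of_ne hjm with hlt | hgt
      · have hz := ih m h hlt
        have hconj : opucInner μ (monicOPUC μ j) (monicOPUC μ m) =
            conj (opucInner μ (monicOPUC μ m) (monicOPUC μ j)) := by
          simp only [opucInner]
          rw [← integral_conj]
          congr 1
          ext z
          simp [mul_comm]
        rw [hconj, hz]; simp
      · rw [ih j j.isLt hgt, mul_zero]
    · simp

end

noncomputable section

/-! ### The sesquilinear form -/

/-! The measure is located through the zeros of the para-orthogonal polynomials N_n = zΦ_n -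
τ_nΦ_n^*, where |τ_n| = 1. Both zΦ_n and Φ_n^* are orthogonal to z, ..., z^n, so N_n is too. This
forces its n + 1 zeros to be simple and to lie on the circle (`paraOPUC_ne_mul`), and makes them
nodes of a positive quadrature that reproduces the moments of μ up to order n (`exists_quadrature`).
Trigonometric polynomials are dense, so a nonempty closed set containing the zeros of every N_n
carries μ (`measure_compl_eq_zero_of_paraOPUC`).

One zero is always z = 1. For the others, `paraOPUC_eval_eq` writes N_n(e^{iθ}) as e^{iθ} - 1 times
a nonvanishing factor times a real sequence W_n with W_{n+1} = 2a_{n+1}W_n - 4d_{n+1}W_{n-1}, where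
a_n = cos(θ/2) - c_n sin(θ/2). If a_n ≥ √q_n^{(1)} for all n, then q_{n+1} ≤ a_n a_{n+1}, so
d_{n+1}/(a_n a_{n+1}) is dominated by a positive chain sequence and W_n > 0 (`threeTerm_pos`). If
instead -a_n ≥ √q_n^{(1)}, the same argument gives (-1)^n W_n > 0.

In terms of θ/4 these inequalities on ±a_n concern the sign of a factorable quadratic form, and the
two cotangent hypotheses say that it has the right sign at ϑ₁ and ϑ₂. Monotonicity extends this to 0
< θ < ϑ₁ and ϑ₂ < θ < 2π. Hence μ lives on the arc together with 1, and removing the mass at 1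
leaves the arc. -/

theorem opucInner_congr (μ : Measure Circle) {p q p' q' : ℂ[X]}
    (h : ∀ z : Circle, p.eval (z : ℂ) * conj (q.eval (z : ℂ)) =
      p'.eval (z : ℂ) * conj (q'.eval (z : ℂ))) : opucInner μ p q = opucInner μ p' q' := by
  simp only [opucInner, h]

theorem opucInner_add_left (μ : Measure Circle) [IsFiniteMeasure μ] (p q r : ℂ[X]) :
    opucInner μ (p + q) r = opucInner μ p r + opucInner μ q r := by
  simp only [opucInner]
  rw [← integral_add (opucInner_integrable μ _ _) (opucInner_integrable μ _ _)]
  simp only [eval_add, add_mul]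

theorem opucInner_C_mul_left (μ : Measure Circle) (a : ℂ) (p q : ℂ[X]) :
    opucInner μ (C a * p) q = a * opucInner μ p q := by
  simp only [opucInner]
  rw [← integral_const_mul]
  simp only [eval_mul, eval_C, mul_assoc]

theorem opucInner_conj_symm (μ : Measure Circle) (p q : ℂ[X]) :
    conj (opucInner μ p q) = opucInner μ q p := by
  simp only [opucInner]
  rw [← integral_conj]
  simp [mul_comm]

theorem opucInner_sub_left (μ : Measure Circle) [IsFiniteMeasure μ] (p q r : ℂ[X]) :
    opucInner μ (p - q) r = opucInner μ p r - opucInner μ q r := by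
  have := opucInner_add_left μ p (C (-1) * q) r
  rw [opucInner_C_mul_left] at this
  simpa [sub_eq_add_neg] using this

theorem opucInner_add_right (μ : Measure Circle) [IsFiniteMeasure μ] (p q r : ℂ[X]) :
    opucInner μ p (q + r) = opucInner μ p q + opucInner μ p r := by
  rw [← opucInner_conj_symm, opucInner_add_left, map_add, opucInner_conj_symm,
    opucInner_conj_symm]

theorem opucInner_sub_right (μ : Measure Circle) [IsFiniteMeasure μ] (p q r : ℂ[X]) :
    opucInner μ p (q - r) = opucInner μ p q - opucInner μ p r := by
  rw [← opucInner_conj_symm, opucInner_sub_left, map_sub, opucInner_conj_symm,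
    opucInner_conj_symm]

theorem opucInner_C_mul_right (μ : Measure Circle) (a : ℂ) (p q : ℂ[X]) :
    opucInner μ p (C a * q) = conj a * opucInner μ p q := by
  rw [← opucInner_conj_symm, opucInner_C_mul_left, map_mul, opucInner_conj_symm]

theorem opucInner_zero_right (μ : Measure Circle) (p : ℂ[X]) : opucInner μ p 0 = 0 := by
  simp [opucInner]

theorem opucInner_zero_left (μ : Measure Circle) (p : ℂ[X]) : opucInner μ 0 p = 0 := by
  simp [opucInner]

theorem opucInner_sum_left (μ : Measure Circle) [IsFiniteMeasure μ] {ι : Type*} (s : Finset ι)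
    (f : ι → ℂ[X]) (q : ℂ[X]) : opucInner μ (∑ i ∈ s, f i) q = ∑ i ∈ s, opucInner μ (f i) q := by
  classical
  induction s using Finset.induction_on with
  | empty => simp [opucInner_zero_left]
  | insert a s ha ih => rw [Finset.sum_insert ha, Finset.sum_insert ha, opucInner_add_left, ih]

theorem opucInner_sum_right (μ : Measure Circle) [IsFiniteMeasure μ] {ι : Type*} (s : Finset ι)
    (f : ι → ℂ[X]) (p : ℂ[X]) : opucInner μ p (∑ i ∈ s, f i) = ∑ i ∈ s, opucInner μ p (f i) := by
  rw [← opucInner_conj_symm, opucInner_sum_left, map_sum]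
  simp only [opucInner_conj_symm]

theorem circle_mul_conj (z : Circle) : (z : ℂ) * conj (z : ℂ) = 1 := by
  rw [Complex.mul_conj]; simp

theorem opucInner_X_mul_X_mul (μ : Measure Circle) (p q : ℂ[X]) :
    opucInner μ (X * p) (X * q) = opucInner μ p q := by
  refine opucInner_congr μ fun z => ?_
  simp only [eval_mul, eval_X, map_mul]
  linear_combination (p.eval (z : ℂ) * conj (q.eval (z : ℂ))) * circle_mul_conj z

theorem opucInner_self (μ : Measure Circle) (p : ℂ[X]) :
    opucInner μ p p = ((∫ z : Circle, ‖p.eval (z : ℂ)‖ ^ 2 ∂μ : ℝ) : ℂ) := by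
  rw [opucInner, ← integral_complex_ofReal]
  congr 1
  ext z
  rw [Complex.mul_conj']
  push_cast
  rfl

/-! ### Reversed polynomials -/

/-- The reversed polynomial `z ^ n * conj (p (1 / conj z))`. -/
def conjReflect (n : ℕ) (p : ℂ[X]) : ℂ[X] := reflect n (p.map (starRingEnd ℂ))

theorem coeff_conjReflect {n k : ℕ} (h : k ≤ n) (p : ℂ[X]) :
    (conjReflect n p).coeff k = conj (p.coeff (n - k)) := by
  simp [conjReflect, coeff_reflect, revAt_le h]

theorem natDegree_conjReflect_le {n : ℕ} {p : ℂ[X]} (h : p.natDegree ≤ n) :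
    (conjReflect n p).natDegree ≤ n := by
  refine natDegree_reflect_le.trans ?_
  simp [h]

theorem eval_conjReflect {n : ℕ} {p : ℂ[X]} (h : p.natDegree ≤ n) {x : ℂ} (hx : x ≠ 0) :
    (conjReflect n p).eval x = x ^ n * conj (p.eval (conj x)⁻¹) := by
  let _ : Invertible x⁻¹ := invertibleOfNonzero (inv_ne_zero hx)
  have h1 := eval₂_reflect_mul_pow (RingHom.id ℂ) x⁻¹ n (p.map (starRingEnd ℂ)) (by simpa using h)
  have h2 : ⅟(x⁻¹) = x := by rw [invOf_eq_inv, inv_inv]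
  have h3 : conj (p.eval (conj x)⁻¹) = (p.map (starRingEnd ℂ)).eval x⁻¹ := by
    rw [eval_map, eval, hom_eval₂]
    simp
  rw [h2] at h1
  change (conjReflect n p).eval x * x⁻¹ ^ n = _ at h1
  rw [h3]
  change _ = x ^ n * eval₂ (RingHom.id ℂ) x⁻¹ (p.map (starRingEnd ℂ))
  rw [← h1, mul_left_comm, ← mul_pow, mul_inv_cancel₀ hx, one_pow, mul_one]

theorem eval_conjReflect_circle {n : ℕ} {p : ℂ[X]} (h : p.natDegree ≤ n) (z : Circle) :
    (conjReflect n p).eval (z : ℂ) = (z : ℂ) ^ n * conj (p.eval (z : ℂ)) := by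
  rw [eval_conjReflect h (Circle.coe_ne_zero z)]
  congr 3
  exact inv_eq_of_mul_eq_one_left (circle_mul_conj z)

theorem opucInner_conjReflect_X_pow (μ : Measure Circle) {n k : ℕ} {p : ℂ[X]}
    (h : p.natDegree ≤ n) (hk : k ≤ n) :
    opucInner μ (conjReflect n p) (X ^ k) = opucInner μ (X ^ (n - k)) p := by
  refine opucInner_congr μ fun z => ?_
  obtain ⟨m, rfl⟩ := Nat.exists_eq_add_of_le hk
  rw [eval_conjReflect_circle h]
  have := circle_mul_conj z
  have h2 : (z : ℂ) ^ k * conj (z : ℂ) ^ k = 1 := by rw [← mul_pow, this, one_pow]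
  simp only [eval_pow, eval_X, map_pow, pow_add, Nat.add_sub_cancel_left]
  linear_combination ((z : ℂ) ^ m * conj (p.eval (z : ℂ))) * h2

theorem opucInner_conjReflect_self (μ : Measure Circle) {n : ℕ} {p : ℂ[X]}
    (h : p.natDegree ≤ n) :
    opucInner μ (conjReflect n p) (conjReflect n p) = opucInner μ p p := by
  refine opucInner_congr μ fun z => ?_
  rw [eval_conjReflect_circle h]
  have h2 : (z : ℂ) ^ n * conj (z : ℂ) ^ n = 1 := by rw [← mul_pow, circle_mul_conj z, one_pow]
  simp only [map_mul, map_pow, Complex.conj_conj]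
  linear_combination (p.eval (z : ℂ) * conj (p.eval (z : ℂ))) * h2

/-! ### Orthogonality and the Szegő recurrence -/

theorem opucInner_monicOPUC_of_degree_lt (μ : Measure Circle) [IsFiniteMeasure μ]
    (hμ : μ.support.Infinite) {n : ℕ} {q : ℂ[X]} (hq : q.degree < n) :
    opucInner μ (monicOPUC μ n) q = 0 := by
  suffices H : ∀ m ≤ n, ∀ q : ℂ[X], q.degree < m → opucInner μ (monicOPUC μ n) q = 0 from
    H n le_rfl q hq
  intro m
  induction m with
  | zero =>
    intro _ q hq
    have : q = 0 := by
      rw [← degree_eq_bot]; simpa [Nat.WithBot.lt_zero_iff] using hq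
    rw [this, opucInner_zero_right]
  | succ m ih =>
    intro hm q hq
    -- Since Φ_m is monic of degree m, subtracting this multiple of it kills the coefficient of z^m.
    have hr : (q - C (q.coeff m) * monicOPUC μ m).degree < m := by
      rw [degree_lt_iff_coeff_zero] at hq ⊢
      intro k hk
      rcases hk.eq_or_lt with rfl | hk
      · have := (monicOPUC_monic μ m).1.coeff_natDegree
        rw [(monicOPUC_monic μ m).2] at this
        simp [this]
      · have : (monicOPUC μ m).coeff k = 0 :=
          coeff_eq_zero_of_natDegree_lt (by rwa [(monicOPUC_monic μ m).2])
        simp [this, hq k hk]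
    have h1 := ih (by omega) _ hr
    rw [opucInner_sub_right, opucInner_C_mul_right, opucInner_monicOPUC_of_lt μ hμ (by omega)] at h1
    simpa using h1

theorem opucInner_X_mul_monicOPUC_X_pow (μ : Measure Circle) [IsFiniteMeasure μ]
    (hμ : μ.support.Infinite) {n k : ℕ} (h1 : 1 ≤ k) (h2 : k ≤ n) :
    opucInner μ (X * monicOPUC μ n) (X ^ k) = 0 := by
  obtain ⟨k, rfl⟩ := Nat.exists_eq_add_of_le' h1
  rw [pow_succ', opucInner_X_mul_X_mul]
  refine opucInner_monicOPUC_of_degree_lt μ hμ ?_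
  rw [degree_X_pow]
  exact_mod_cast h2

theorem opucInner_conjReflect_monicOPUC_X_pow (μ : Measure Circle) [IsFiniteMeasure μ]
    (hμ : μ.support.Infinite) {n k : ℕ} (h1 : 1 ≤ k) (h2 : k ≤ n) :
    opucInner μ (conjReflect n (monicOPUC μ n)) (X ^ k) = 0 := by
  rw [opucInner_conjReflect_X_pow μ (monicOPUC_monic μ n).2.le h2, ← opucInner_conj_symm,
    opucInner_monicOPUC_of_degree_lt μ hμ, map_zero]
  rw [degree_X_pow]
  exact_mod_cast (by omega : n - k < n)

/-- A polynomial of degree at most n without constant term is a combination of z, ..., z^n. This is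
the only orthogonality shared by zΦ_n, Φ_n^* and N_n, and the only one used for N_n. -/
theorem opucInner_eq_zero_of_X_dvd (μ : Measure Circle) [IsFiniteMeasure μ] {n : ℕ} {p q : ℂ[X]}
    (hp : ∀ k, 1 ≤ k → k ≤ n → opucInner μ p (X ^ k) = 0) (hq : q.natDegree ≤ n)
    (h0 : q.coeff 0 = 0) : opucInner μ p q = 0 := by
  rw [q.as_sum_range_C_mul_X_pow, opucInner_sum_right]
  refine Finset.sum_eq_zero fun k hk => ?_
  rw [opucInner_C_mul_right]
  rcases Nat.eq_zero_or_pos k with rfl | hk0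
  · simp [h0]
  · rw [hp k hk0 (by simp at hk; omega), mul_zero]

theorem coeff_zero_conjReflect_monicOPUC (μ : Measure Circle) (n : ℕ) :
    (conjReflect n (monicOPUC μ n)).coeff 0 = 1 := by
  have := (monicOPUC_monic μ n).1.coeff_natDegree
  rw [(monicOPUC_monic μ n).2] at this
  rw [coeff_conjReflect (Nat.zero_le n)]
  simp [this]

/-- The difference D of the two sides is orthogonal to z, ..., z^n; its degree is at most n because
the leading terms cancel; and D(0) = 0 by the definition of α_n. So D is orthogonal to itself, and
infinite support gives D = 0. -/
theorem monicOPUC_succ (μ : Measure Circle) [IsFiniteMeasure μ] (hμ : μ.support.Infinite)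
    (n : ℕ) : monicOPUC μ (n + 1) =
      X * monicOPUC μ n - C (conj (verblunsky μ n)) * conjReflect n (monicOPUC μ n) := by
  set P := conjReflect n (monicOPUC μ n) with hP
  set D := monicOPUC μ (n + 1) - (X * monicOPUC μ n - C (conj (verblunsky μ n)) * P) with hD
  suffices D = 0 from sub_eq_zero.1 this
  by_contra hne
  refine opucInner_self_ne_zero μ hμ hne ?_
  have hm := monicOPUC_monic μ
  refine opucInner_eq_zero_of_X_dvd (n := n) μ (fun k h1 h2 => ?_) ?_ ?_
  · rw [hD, opucInner_sub_left, opucInner_sub_left, opucInner_C_mul_left,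
      opucInner_X_mul_monicOPUC_X_pow μ hμ h1 h2, opucInner_conjReflect_monicOPUC_X_pow μ hμ h1 h2,
      opucInner_monicOPUC_of_degree_lt μ hμ]
    · simp
    · rw [degree_X_pow]; exact_mod_cast (by omega : k < n + 1)
  · rw [natDegree_le_iff_coeff_eq_zero]
    intro k hk
    have hPk : P.coeff k = 0 := coeff_eq_zero_of_natDegree_lt
      ((natDegree_conjReflect_le (hm n).2.le).trans_lt hk)
    obtain ⟨k, rfl⟩ := Nat.exists_eq_add_of_le' (by omega : 1 ≤ k)
    rcases (by omega : n = k ∨ n < k) with rfl | hk'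
    · have e1 := (hm (n + 1)).1.coeff_natDegree
      have e2 := (hm n).1.coeff_natDegree
      rw [(hm _).2] at e1 e2
      simp [hD, e1, e2, hPk]
    · have e1 : (monicOPUC μ (n + 1)).coeff (k + 1) = 0 :=
        coeff_eq_zero_of_natDegree_lt (by rw [(hm _).2]; omega)
      have e2 : (monicOPUC μ n).coeff k = 0 :=
        coeff_eq_zero_of_natDegree_lt (by rw [(hm _).2]; omega)
      simp [hD, e1, e2, hPk]
  · simp [hD, verblunsky, hP, coeff_zero_eq_eval_zero]
    simp [← coeff_zero_eq_eval_zero, coeff_zero_conjReflect_monicOPUC]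

/-- Pythagoras in zΦ_n = Φ_{n+1} + conj(α_n)Φ_n^*: the summands are orthogonal, and zΦ_n, Φ_n^* have
the norm of Φ_n. Hence ‖Φ_{n+1}‖² = (1 - |α_n|²)‖Φ_n‖², with both norms positive. -/
theorem norm_verblunsky_lt_one (μ : Measure Circle) [IsFiniteMeasure μ]
    (hμ : μ.support.Infinite) (n : ℕ) : ‖verblunsky μ n‖ < 1 := by
  set P := conjReflect n (monicOPUC μ n) with hP
  have hm := monicOPUC_monic μ
  have hdeg : P.degree < (n + 1 : ℕ) := by
    refine lt_of_le_of_lt degree_le_natDegree ?_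
    exact_mod_cast Nat.lt_succ_of_le (natDegree_conjReflect_le (hm n).2.le)
  have h0 : opucInner μ (monicOPUC μ (n + 1)) P = 0 :=
    opucInner_monicOPUC_of_degree_lt μ hμ hdeg
  have h0' : opucInner μ P (monicOPUC μ (n + 1)) = 0 := by
    rw [← opucInner_conj_symm, h0, map_zero]
  have e : X * monicOPUC μ n = monicOPUC μ (n + 1) + C (conj (verblunsky μ n)) * P := by
    rw [monicOPUC_succ μ hμ n]; ring
  have h1 := opucInner_X_mul_X_mul μ (monicOPUC μ n) (monicOPUC μ n)
  rw [e, opucInner_add_left, opucInner_add_right, opucInner_add_right, opucInner_C_mul_left,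
    opucInner_C_mul_left, opucInner_C_mul_right, opucInner_C_mul_right, h0, h0', hP,
    opucInner_conjReflect_self μ (hm n).2.le, Complex.conj_conj] at h1
  have hpos : ∀ k, ∃ r : ℝ, 0 < r ∧ opucInner μ (monicOPUC μ k) (monicOPUC μ k) = r := by
    intro k
    refine ⟨_, lt_of_le_of_ne (integral_nonneg fun z => by positivity) (fun h => ?_),
      opucInner_self μ _⟩
    refine opucInner_self_ne_zero μ hμ (hm k).1.ne_zero ?_
    rw [opucInner_self]
    exact_mod_cast h.symm
  obtain ⟨r, hr, er⟩ := hpos n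
  obtain ⟨s, hs, es⟩ := hpos (n + 1)
  rw [er, es] at h1
  have h2 : (s : ℂ) + (‖verblunsky μ n‖ ^ 2 : ℝ) * r = r := by
    push_cast
    rw [← Complex.mul_conj']
    linear_combination h1
  have h3 : s + ‖verblunsky μ n‖ ^ 2 * r = r := by exact_mod_cast h2
  by_contra hge
  push Not at hge
  nlinarith [mul_le_mul_of_nonneg_right (one_le_pow₀ hge : 1 ≤ ‖verblunsky μ n‖ ^ 2) hr.le]

/-! ### The sequence `τ_n` -/

/-- For |τ| = 1 the numerator τ - conj α equals τ · conj(1 - τα), so numerator and denominator have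
the same modulus. -/
theorem norm_tauSeq {α : ℕ → ℂ} (hα : ∀ n, ‖α n‖ < 1) (n : ℕ) : ‖tauSeq α n‖ = 1 := by
  induction n with
  | zero => simp [tauSeq]
  | succ n ih =>
    have hne : 1 - tauSeq α n * α n ≠ 0 := by
      intro h
      have : ‖tauSeq α n * α n‖ = 1 := by rw [← sub_eq_zero.1 h]; simp
      rw [norm_mul, ih, one_mul] at this
      exact (hα n).ne this
    have hc : tauSeq α n * conj (tauSeq α n) = 1 := by rw [Complex.mul_conj']; simp [ih]
    have e : tauSeq α n - conj (α n) = tauSeq α n * conj (1 - tauSeq α n * α n) := by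
      simp only [map_sub, map_one, map_mul]
      linear_combination (conj (α n)) * hc
    rw [tauSeq, e, norm_div, norm_mul, ih, Complex.norm_conj, one_mul,
      div_self (norm_ne_zero_iff.2 hne)]

theorem re_one_sub_tauSeq_mul_pos {α : ℕ → ℂ} (hα : ∀ n, ‖α n‖ < 1) (n : ℕ) :
    0 < 1 - (tauSeq α n * α n).re := by
  have h : ‖tauSeq α n * α n‖ < 1 := by rw [norm_mul, norm_tauSeq hα, one_mul]; exact hα n
  linarith [Complex.re_le_norm (tauSeq α n * α n)]

/-! ### A real three-term recurrence and chain sequences -/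

/-- The solution of `W_{n+1} = 2 a_{n+1} W_n - 4 d_{n+1} W_{n-1}`, `W_0 = 1`, `W_1 = 2 a_1`. -/
def threeTerm (a d : ℕ → ℝ) : ℕ → ℝ
  | 0 => 1
  | 1 => 2 * a 1
  | n + 2 => 2 * a (n + 2) * threeTerm a d (n + 1) - 4 * d (n + 2) * threeTerm a d n

theorem threeTerm_neg (a d : ℕ → ℝ) (n : ℕ) :
    threeTerm (-a) d n = (-1) ^ n * threeTerm a d n := by
  induction n using Nat.twoStepInduction with
  | zero => simp [threeTerm]
  | one => simp [threeTerm]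
  | more n h1 h2 =>
    simp only [threeTerm, h1, h2, Pi.neg_apply]
    ring

theorem le_qOne_left (q : ℕ → ℝ) (n : ℕ) : q (n + 1) ≤ qOne q n := by
  unfold qOne
  split_ifs with h
  · rw [h]
  · exact le_max_right _ _

theorem le_qOne_right (q : ℕ → ℝ) {n : ℕ} (hn : 1 ≤ n) : q (n + 1) ≤ qOne q (n + 1) := by
  unfold qOne
  rw [if_neg (by omega)]
  exact le_max_left _ _

theorem qOne_pos {q d : ℕ → ℝ} (hq : IsScalingSeq q d) {n : ℕ} (hn : 1 ≤ n) : 0 < qOne q n :=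
  (hq.1 n hn).1.trans_le (le_qOne_left q _)

theorem qOne_le_one {q d : ℕ → ℝ} (hq : IsScalingSeq q d) {n : ℕ} (hn : 1 ≤ n) :
    qOne q n ≤ 1 := by
  unfold qOne
  split_ifs with h
  · exact (hq.1 1 le_rfl).2
  · obtain ⟨n, rfl⟩ := Nat.exists_eq_add_of_le' hn
    exact max_le (hq.1 n (by omega)).2 (hq.1 (n + 1) hn).2

/-- The parameters h_n of the chain sequence d/q bound the ratios: W_{n+1} ≥ 2a_{n+1}(1 -
h_{n+1})W_n. This propagates, because 4d_{n+2}W_n ≤ 2a_{n+2}h_{n+2} · 2a_{n+1}(1 - h_{n+1})W_n ≤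
2a_{n+2}h_{n+2}W_{n+1}. -/
theorem threeTerm_pos {a d q : ℕ → ℝ} (hq : IsScalingSeq q d)
    (ha : ∀ n, 1 ≤ n → √(qOne q n) ≤ a n) (n : ℕ) : 0 < threeTerm a d n := by
  obtain ⟨h, h1, h2, hd⟩ := hq.2
  have hapos : ∀ n, 1 ≤ n → 0 < a n := fun n hn =>
    (Real.sqrt_pos.2 (qOne_pos hq hn)).trans_le (ha n hn)
  have hlt : ∀ n, 1 ≤ n → h n < 1 := fun n hn => by
    rcases hn.eq_or_lt with rfl | hn
    · exact h1.2
    · exact (h2 n hn).2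
  suffices H : ∀ n, 0 < threeTerm a d n ∧
      2 * a (n + 1) * (1 - h (n + 1)) * threeTerm a d n ≤ threeTerm a d (n + 1) from (H n).1
  intro n
  induction n with
  | zero =>
    refine ⟨by simp [threeTerm], ?_⟩
    simp only [threeTerm, zero_add]
    nlinarith [mul_nonneg (hapos 1 le_rfl).le h1.1]
  | succ n ih =>
    have hn : 1 ≤ n + 1 := by omega
    have ha1 := hapos _ hn
    have ha2 := hapos (n + 2) (by omega)
    have hl := hlt _ hn
    have hpos : 0 < threeTerm a d (n + 1) := by
      refine lt_of_lt_of_le ?_ ih.2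
      have : 0 < 1 - h (n + 1) := by linarith
      have := ih.1
      positivity
    refine ⟨hpos, ?_⟩
    have hh2 := h2 (n + 2) (by omega)
    obtain ⟨q0, -⟩ := hq.1 (n + 1) hn
    -- The reason for the maximum in q^{(1)}: each q_{k+1} is at most both q_k^{(1)} and
    -- q_{k+1}^{(1)}.
    have hqa : q (n + 2) ≤ a (n + 1) * a (n + 2) := by
      calc q (n + 2) = √(q (n + 2)) * √(q (n + 2)) := (Real.mul_self_sqrt q0.le).symm
        _ ≤ √(qOne q (n + 1)) * √(qOne q (n + 2)) := by
          gcongr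
          · exact le_qOne_left q _
          · exact le_qOne_right q hn
        _ ≤ _ := mul_le_mul (ha _ hn) (ha _ (by omega)) (Real.sqrt_nonneg _) ha1.le
    have hde : d (n + 2) = q (n + 2) * ((1 - h (n + 1)) * h (n + 2)) := by
      have := hd (n + 1) hn
      simp only at this
      rw [← this, mul_div_cancel₀ _ q0.ne']
    have h3 : q (n + 2) * ((1 - h (n + 1)) * h (n + 2) * threeTerm a d n) ≤
        a (n + 1) * a (n + 2) * ((1 - h (n + 1)) * h (n + 2) * threeTerm a d n) := by
      refine mul_le_mul_of_nonneg_right hqa ?_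
      have : 0 < 1 - h (n + 1) := by linarith
      have := ih.1
      have := hh2.1
      positivity
    have h4 := mul_le_mul_of_nonneg_left ih.2 (mul_pos ha2 hh2.1).le
    simp only [threeTerm]
    rw [hde]
    linarith

/-! ### Para-orthogonal polynomials -/

/-- The para-orthogonal polynomial `z Φ_n - τ_n Φ_n^*`. -/
def paraOPUC (μ : Measure Circle) (n : ℕ) : ℂ[X] :=
  X * monicOPUC μ n - C (tauSeq (verblunsky μ) n) * conjReflect n (monicOPUC μ n)

theorem conjReflect_monicOPUC_succ_eval (μ : Measure Circle) [IsFiniteMeasure μ]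
    (hμ : μ.support.Infinite) (n : ℕ) (z : Circle) :
    (conjReflect (n + 1) (monicOPUC μ (n + 1))).eval (z : ℂ) =
      (conjReflect n (monicOPUC μ n)).eval (z : ℂ) -
        verblunsky μ n * z * (monicOPUC μ n).eval (z : ℂ) := by
  have hm := monicOPUC_monic μ
  rw [eval_conjReflect_circle (hm _).2.le, monicOPUC_succ μ hμ n]
  simp only [eval_sub, eval_mul, eval_X, eval_C, eval_conjReflect_circle (hm n).2.le, map_sub,
    map_mul, map_pow, Complex.conj_conj]
  have h1 := circle_mul_conj z
  have h2 : (z : ℂ) ^ n * conj (z : ℂ) ^ n = 1 := by rw [← mul_pow, h1, one_pow]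
  linear_combination (z : ℂ) ^ n * conj ((monicOPUC μ n).eval (z : ℂ)) * h1
    - verblunsky μ n * z * (monicOPUC μ n).eval (z : ℂ) * h2

/-- The factor `e^{inθ/2} ∏_{k<n} Re w_k / w_k`, `w_k = 1 - τ_k α_k`, relating the para-orthogonal
polynomials on the circle to the real three-term recurrence. -/
def paraFactor (α : ℕ → ℂ) (ρ : ℂ) (n : ℕ) : ℂ :=
  ρ ^ n * ∏ k ∈ Finset.range n,
    ((1 - (tauSeq α k * α k).re : ℝ) : ℂ) / (1 - tauSeq α k * α k)

theorem monicOPUC_zero (μ : Measure Circle) : monicOPUC μ 0 = 1 := by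
  rw [monicOPUC]
  simp

/-- With w_k = 1 - τ_kα_k, the Szegő recurrence becomes a first-order system for N_n and G_n = Φ_n -
τ_nΦ_n^*. Eliminating G leaves a three-term recurrence for N, and dividing by e^{inθ/2} ∏ Re w_k /
w_k makes its coefficients real. -/
theorem paraOPUC_eval_eq (μ : Measure Circle) [IsFiniteMeasure μ] (hμ : μ.support.Infinite)
    (θ : ℝ) (n : ℕ) :
    (paraOPUC μ n).eval (Circle.exp θ : ℂ) = ((Circle.exp θ : ℂ) - 1) *
      paraFactor (verblunsky μ) (Circle.exp (θ / 2)) n *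
      threeTerm (fun n => Real.cos (θ / 2) - cSeq (verblunsky μ) n * Real.sin (θ / 2))
        (dSeq (verblunsky μ)) n := by
  set α := verblunsky μ with hαdef
  have hα : ∀ n, ‖α n‖ < 1 := norm_verblunsky_lt_one μ hμ
  set ρ : ℂ := (Circle.exp (θ / 2) : ℂ) with hρ
  set ζ : ℂ := (Circle.exp θ : ℂ) with hζ
  have hζρ : ζ = ρ ^ 2 := by
    rw [hζ, hρ, ← Circle.coe_pow]
    congr 1
    rw [sq, ← Circle.exp_add]
    congr 1; ring
  have hρρ : ρ * conj ρ = 1 := circle_mul_conj _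
  have hx : ρ + conj ρ = 2 * (Real.cos (θ / 2) : ℝ) := by
    rw [Complex.add_conj, hρ, Circle.coe_exp, Complex.exp_ofReal_mul_I_re]; push_cast; ring
  have hy : ρ - conj ρ = 2 * (Real.sin (θ / 2) : ℝ) * Complex.I := by
    rw [Complex.sub_conj, hρ, Circle.coe_exp, Complex.exp_ofReal_mul_I_im]; push_cast; ring
  set w : ℕ → ℂ := fun n => 1 - tauSeq α n * α n with hw
  have hwre : ∀ n, (w n).re = 1 - (tauSeq α n * α n).re := fun n => by simp [hw]
  have hwim : ∀ n, (w n).im = -(tauSeq α n * α n).im := fun n => by simp [hw]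
  have hr : ∀ n, 0 < (w n).re := fun n => by
    rw [hwre]; exact re_one_sub_tauSeq_mul_pos hα n
  have hw0 : ∀ n, w n ≠ 0 := fun n h => by have := hr n; rw [h] at this; simp at this
  have hττ : ∀ n, tauSeq α n * conj (tauSeq α n) = 1 := fun n => by
    rw [Complex.mul_conj']; simp [norm_tauSeq hα n]
  -- This and the next two identities express α_n, conj α_n and τ_{n+1} through τ_n and w_n.
  have hτα : ∀ n, tauSeq α n * α n = 1 - w n := fun n => by simp [hw]
  have hcα : ∀ n, conj (α n) = tauSeq α n * (1 - conj (w n)) := fun n => by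
    simp only [hw, map_sub, map_one, map_mul]
    linear_combination -(conj (α n)) * hττ n
  have hτ : ∀ n, tauSeq α (n + 1) * w n = tauSeq α n * conj (w n) := fun n => by
    rw [tauSeq, div_mul_cancel₀ _ (hw0 n), hcα n]; ring
  -- the recurrence of the para-orthogonal polynomials
  set φ : ℕ → ℂ := fun n => (monicOPUC μ n).eval ζ with hφ
  set ψ : ℕ → ℂ := fun n => (conjReflect n (monicOPUC μ n)).eval ζ with hψ
  have hφs : ∀ n, φ (n + 1) = ζ * φ n - conj (α n) * ψ n := fun n => by
    simp [hφ, monicOPUC_succ μ hμ n, hψ, hαdef]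
  have hψs : ∀ n, ψ (n + 1) = ψ n - α n * ζ * φ n := fun n =>
    conjReflect_monicOPUC_succ_eval μ hμ n _
  set N : ℕ → ℂ := fun n => ζ * φ n - tauSeq α n * ψ n with hN
  set G : ℕ → ℂ := fun n => φ n - tauSeq α n * ψ n with hG
  have hGs : ∀ n, w n * G (n + 1) = (1 - α n * conj (α n)) * N n := fun n => by
    simp only [hG, hN, hφs, hψs]
    linear_combination (-ψ n + α n * ζ * φ n) * hτ n +
      (α n * ζ * φ n - w n * ψ n - α n * tauSeq α n * ψ n) * hcα n +
      (ζ * φ n - tauSeq α n * ψ n * (1 - conj (w n))) * hτα n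
  have hNs : ∀ n, w n * N (n + 1) =
      (ζ * w n + conj (w n)) * N n - ζ * (w n * conj (w n)) * G n := fun n => by
    simp only [hG, hN, hφs, hψs]
    linear_combination (-ψ n + α n * ζ * φ n) * hτ n - ζ * ψ n * w n * hcα n
      + ζ * φ n * conj (w n) * hτα n
  have hcSeq : ∀ n, cSeq α (n + 1) = (w n).im / (w n).re := fun n => by
    rw [hwre, hwim]; rfl
  have hconj : ∀ n, conj (w n) = ((w n).re : ℂ) - ((w n).im : ℂ) * Complex.I := fun n => by
    apply Complex.ext <;> simp
  have hself : ∀ n, w n = ((w n).re : ℂ) + ((w n).im : ℂ) * Complex.I := fun n =>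
    (Complex.re_add_im _).symm
  -- `2 (cos (θ/2) - c sin (θ/2)) Re w = ρ w + conj (ρ w)`
  have ha : ∀ n, 2 * ((Real.cos (θ / 2) - cSeq α (n + 1) * Real.sin (θ / 2) : ℝ) : ℂ) *
      ((w n).re : ℂ) = ρ * w n + conj ρ * conj (w n) := fun n => by
    have h0 : ((w n).re : ℂ) ≠ 0 := by exact_mod_cast (hr n).ne'
    rw [hcSeq n, hconj n]
    nth_rw 4 [hself n]
    push_cast at hx hy ⊢
    field_simp
    linear_combination (-((w n).re : ℂ)) * hx - (w n).im * Complex.I * hy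
      - 2 * (w n).im * Complex.sin (θ / 2) * Complex.I_sq
  -- From |α_n|² = |1 - w_n|² one gets 1 - |α_n|² = 2 Re w_n - |w_n|², which is 2(1 - g_{n+1}) Re
  -- w_n.
  have hd : ∀ n, 4 * ((dSeq α (n + 2) : ℝ) : ℂ) * ((w n).re * (w (n + 1)).re) =
      (1 - α n * conj (α n)) * (w (n + 1) * conj (w (n + 1))) := fun n => by
    have h0 : ((w n).re : ℂ) ≠ 0 := by exact_mod_cast (hr n).ne'
    have h1 : ((w (n + 1)).re : ℂ) ≠ 0 := by exact_mod_cast (hr (n + 1)).ne'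
    have e : dSeq α (n + 2) = (1 - 1 / 2 * (‖w n‖ ^ 2 / (w n).re)) *
        (1 / 2 * (‖w (n + 1)‖ ^ 2 / (w (n + 1)).re)) := by
      rw [hwre, hwre]; rfl
    have e2 : α n * conj (α n) = (1 - w n) * (1 - conj (w n)) := by
      linear_combination (α n) * hcα n + (1 - conj (w n)) * hτα n
    have e3 : w n + conj (w n) = 2 * (w n).re := by rw [Complex.add_conj]; push_cast; ring
    rw [e, e2, Complex.mul_conj']
    push_cast
    rw [← Complex.mul_conj' (w n)]
    field_simp
    linear_combination (-4 * (‖w (n + 1)‖ : ℂ) ^ 2) * e3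
  set W := threeTerm (fun n => Real.cos (θ / 2) - cSeq α n * Real.sin (θ / 2)) (dSeq α) with hW
  have hF : ∀ n, paraFactor α ρ (n + 1) * w n = paraFactor α ρ n * (ρ * (w n).re) := fun n => by
    simp only [paraFactor, Finset.prod_range_succ, pow_succ, ← hwre]
    change _ * (_ * (_ / w n)) * w n = _
    field_simp [hw0 n]
  have hN0 : N 0 = ζ - 1 := by
    simp [hN, hφ, hψ, tauSeq, monicOPUC_zero, conjReflect]
  have hG0 : G 0 = 0 := by
    simp [hG, hφ, hψ, tauSeq, monicOPUC_zero, conjReflect]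
  have heval : (paraOPUC μ n).eval ζ = N n := by
    simp [paraOPUC, hN, hφ, hψ, hαdef]
  rw [heval]
  clear heval
  induction n using Nat.twoStepInduction with
  | zero => simp [hN0, paraFactor, hW, threeTerm]
  | one =>
    refine mul_left_cancel₀ (hw0 0) ?_
    have e1 := hNs 0
    have e2 := hF 0
    have e3 := ha 0
    have e4 : paraFactor α ρ 0 = 1 := by simp [paraFactor]
    rw [hG0, hN0] at e1
    rw [e4] at e2
    have e5 : W 1 = 2 * (Real.cos (θ / 2) - cSeq α 1 * Real.sin (θ / 2)) := rfl
    rw [e5]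
    simp only [zero_add] at e1 e2 e3
    push_cast at e3 ⊢
    linear_combination e1 - (ζ - 1) * (2 * (Complex.cos (θ / 2) - cSeq α 1 * Complex.sin (θ / 2))) *
      e2 - (ζ - 1) * ρ * e3 + (ζ - 1) * (w 0 * hζρ - conj (w 0) * hρρ)
  | more n h1 h2 =>
    refine mul_left_cancel₀ (mul_ne_zero (hw0 n) (hw0 (n + 1))) ?_
    have e1 := hNs (n + 1)
    have e2 := hGs n
    have e3 := hF n
    have e4 := hF (n + 1)
    have e5 := ha (n + 1)
    have e6 := hd n
    have e7 : W (n + 2) = 2 * (Real.cos (θ / 2) - cSeq α (n + 2) * Real.sin (θ / 2)) * W (n + 1) -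
      4 * dSeq α (n + 2) * W n := rfl
    rw [e7]
    push_cast at e5 ⊢
    set a : ℂ := Complex.cos (θ / 2) - cSeq α (n + 2) * Complex.sin (θ / 2)
    set b : ℂ := 1 - α n * conj (α n)
    linear_combination w n * e1 - ζ * w (n + 1) * conj (w (n + 1)) * e2 +
      w n * (ζ * w (n + 1) + conj (w (n + 1))) * h2 -
      ζ * w (n + 1) * conj (w (n + 1)) * b * h1 -
      w n * (ζ - 1) * (2 * a * W (n + 1) - 4 * dSeq α (n + 2) * W n) * e4 +
      4 * dSeq α (n + 2) * W n * (ζ - 1) * ρ * (w (n + 1)).re * e3 -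
      w n * paraFactor α ρ (n + 1) * ρ * (ζ - 1) * W (n + 1) * e5 +
      (ζ - 1) * paraFactor α ρ n * ρ ^ 2 * W n * e6 +
      w n * paraFactor α ρ (n + 1) * (ζ - 1) * W (n + 1) *
        (w (n + 1) * hζρ - conj (w (n + 1)) * hρρ) -
      (ζ - 1) * paraFactor α ρ n * W n * b * w (n + 1) * conj (w (n + 1)) * hζρ

/-! ### Zeros of para-orthogonal polynomials and quadrature on the unit circle -/

theorem natDegree_paraOPUC_aux (μ : Measure Circle) (n : ℕ) :
    (C (tauSeq (verblunsky μ) n) * conjReflect n (monicOPUC μ n)).degree <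
      (X * monicOPUC μ n).degree := by
  have hm := monicOPUC_monic μ n
  have h1 : (X * monicOPUC μ n).degree = ((n + 1 : ℕ) : WithBot ℕ) := by
    rw [degree_mul, degree_X, degree_eq_natDegree hm.1.ne_zero, hm.2]
    push_cast; ring
  rw [h1]
  refine lt_of_le_of_lt degree_le_natDegree ?_
  exact_mod_cast Nat.lt_succ_of_le
    ((natDegree_C_mul_le _ _).trans (natDegree_conjReflect_le hm.2.le))

theorem monic_paraOPUC (μ : Measure Circle) (n : ℕ) : (paraOPUC μ n).Monic :=
  (monic_X.mul (monicOPUC_monic μ n).1).sub_of_left (natDegree_paraOPUC_aux μ n)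

theorem natDegree_paraOPUC (μ : Measure Circle) (n : ℕ) : (paraOPUC μ n).natDegree = n + 1 := by
  have hm := monicOPUC_monic μ n
  rw [paraOPUC, natDegree_sub_eq_left_of_natDegree_lt, natDegree_X_mul hm.1.ne_zero, hm.2]
  rw [natDegree_X_mul hm.1.ne_zero, hm.2]
  exact Nat.lt_succ_of_le ((natDegree_C_mul_le _ _).trans (natDegree_conjReflect_le hm.2.le))

theorem opucInner_paraOPUC_X_pow (μ : Measure Circle) [IsFiniteMeasure μ]
    (hμ : μ.support.Infinite) {n k : ℕ} (h1 : 1 ≤ k) (h2 : k ≤ n) :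
    opucInner μ (paraOPUC μ n) (X ^ k) = 0 := by
  rw [paraOPUC, opucInner_sub_left, opucInner_C_mul_left,
    opucInner_X_mul_monicOPUC_X_pow μ hμ h1 h2, opucInner_conjReflect_monicOPUC_X_pow μ hμ h1 h2]
  simp

theorem paraOPUC_eval_zero_ne (μ : Measure Circle) [IsFiniteMeasure μ]
    (hμ : μ.support.Infinite) (n : ℕ) : (paraOPUC μ n).eval 0 ≠ 0 := by
  have h := norm_tauSeq (norm_verblunsky_lt_one μ hμ) n
  rw [← coeff_zero_eq_eval_zero, paraOPUC]
  simp only [coeff_sub, mul_coeff_zero, coeff_X_zero, zero_mul, coeff_C_zero,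
    coeff_zero_conjReflect_monicOPUC, zero_sub, mul_one]
  rw [Ne, neg_eq_zero, ← norm_eq_zero, h]
  exact one_ne_zero

/-- Since |τ_n| = 1, N_n is self-inversive: z^{n+1} conj(N_n(1/conj z)) = -conj(τ_n) N_n(z). -/
theorem paraOPUC_eval_inv_conj (μ : Measure Circle) [IsFiniteMeasure μ]
    (hμ : μ.support.Infinite) {n : ℕ} {w : ℂ} (hw : (paraOPUC μ n).eval w = 0) :
    (paraOPUC μ n).eval (conj w)⁻¹ = 0 := by
  have h := norm_tauSeq (norm_verblunsky_lt_one μ hμ) n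
  have hw0 : w ≠ 0 := fun h0 => paraOPUC_eval_zero_ne μ hμ n (h0 ▸ hw)
  have hc0 : conj w ≠ 0 := by simpa using hw0
  have hd := (monicOPUC_monic μ n).2.le
  have hττ : tauSeq (verblunsky μ) n * conj (tauSeq (verblunsky μ) n) = 1 := by
    rw [Complex.mul_conj']; simp [h]
  have e1 := eval_conjReflect hd hw0
  have e2 := eval_conjReflect hd (inv_ne_zero hc0)
  simp only [map_inv₀, Complex.conj_conj, inv_inv] at e2
  simp only [paraOPUC, eval_sub, eval_mul, eval_X, eval_C] at hw ⊢
  rw [e1] at hw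
  rw [e2]
  have h3 := congrArg conj hw
  simp only [map_sub, map_mul, map_pow, Complex.conj_conj, map_zero] at h3
  have h4 : (conj w)⁻¹ * conj w = 1 := inv_mul_cancel₀ hc0
  have h5 : (conj w)⁻¹ ^ n * conj w ^ n = 1 := by rw [← mul_pow, h4, one_pow]
  set u := (conj w)⁻¹
  linear_combination (-tauSeq (verblunsky μ) n * u ^ (n + 1)) * h3 +
    tauSeq (verblunsky μ) n * u ^ n * conj ((monicOPUC μ n).eval w) * h4 -
    u * (monicOPUC μ n).eval u * (u ^ n * conj w ^ n * hττ + h5)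

/-- On the circle conj z (z - w') = -w' conj(z - w), so such a factorization would give ⟨N_n, zS⟩ =
-w'‖(z - w)S‖² ≠ 0, although zS lies in the span of z, ..., z^n. Taking w' = 1/conj w excludes zeros
off the circle; taking w' = w with |w| = 1 excludes double zeros. -/
theorem paraOPUC_ne_mul (μ : Measure Circle) [IsFiniteMeasure μ]
    (hμ : μ.support.Infinite) {n : ℕ} {w w' : ℂ} (hww : w' * conj w = 1) (S : ℂ[X]) :
    paraOPUC μ n ≠ (X - C w) * ((X - C w') * S) := by
  intro h
  have hmon := monic_paraOPUC μ n
  have hS0 : S ≠ 0 := by rintro rfl; simp [h] at hmon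
  have hdeg : S.natDegree + 1 = n := by
    have := natDegree_paraOPUC μ n
    rw [h, natDegree_mul (X_sub_C_ne_zero _) (mul_ne_zero (X_sub_C_ne_zero _) hS0),
      natDegree_mul (X_sub_C_ne_zero _) hS0] at this
    simp only [natDegree_X_sub_C] at this
    omega
  have h0 : opucInner μ (paraOPUC μ n) (X * S) = 0 := by
    refine opucInner_eq_zero_of_X_dvd μ (fun k => opucInner_paraOPUC_X_pow μ hμ) ?_ (by simp)
    rw [natDegree_X_mul hS0, hdeg]
  refine opucInner_self_ne_zero μ hμ (p := (X - C w) * S)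
    (mul_ne_zero (X_sub_C_ne_zero _) hS0) ?_
  have hw' : w' ≠ 0 := left_ne_zero_of_mul_eq_one hww
  have : opucInner μ (paraOPUC μ n) (X * S) =
      opucInner μ (C (-w') * ((X - C w) * S)) ((X - C w) * S) := by
    refine opucInner_congr μ fun z => ?_
    rw [h]
    simp only [eval_mul, eval_sub, eval_X, eval_C, map_mul, map_sub]
    linear_combination ((z - w) * S.eval (z : ℂ) * conj (S.eval (z : ℂ))) *
      (circle_mul_conj z - hww)
  rw [this, opucInner_C_mul_left] at h0
  exact (mul_eq_zero.1 h0).resolve_left (neg_ne_zero.2 hw')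

theorem norm_eq_one_of_paraOPUC_eval_eq_zero (μ : Measure Circle) [IsFiniteMeasure μ]
    (hμ : μ.support.Infinite) {n : ℕ} {w : ℂ} (hw : (paraOPUC μ n).eval w = 0) : ‖w‖ = 1 := by
  have hw0 : w ≠ 0 := fun h0 => paraOPUC_eval_zero_ne μ hμ n (h0 ▸ hw)
  have hc0 : conj w ≠ 0 := by simpa using hw0
  by_contra hne
  have hne' : (conj w)⁻¹ ≠ w := by
    intro h
    have h1 : w * conj w = 1 := by nth_rw 1 [← h]; exact inv_mul_cancel₀ hc0
    rw [Complex.mul_conj'] at h1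
    have h2 : ‖w‖ ^ 2 = 1 := by exact_mod_cast h1
    exact hne ((pow_eq_one_iff_of_nonneg (norm_nonneg _) two_ne_zero).1 h2)
  obtain ⟨Q, hQ⟩ := dvd_iff_isRoot.2 hw
  have h2 := paraOPUC_eval_inv_conj μ hμ hw
  rw [hQ, eval_mul] at h2
  have h3 : Q.IsRoot (conj w)⁻¹ := by
    refine (mul_eq_zero.1 h2).resolve_left ?_
    simpa [sub_eq_zero] using hne'
  obtain ⟨S, rfl⟩ := dvd_iff_isRoot.2 h3
  exact paraOPUC_ne_mul μ hμ (inv_mul_cancel₀ hc0) S hQ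

theorem nodup_roots_paraOPUC (μ : Measure Circle) [IsFiniteMeasure μ]
    (hμ : μ.support.Infinite) (n : ℕ) : (paraOPUC μ n).roots.Nodup := by
  rw [Multiset.nodup_iff_count_le_one]
  intro w
  rw [count_roots]
  by_contra hlt
  push Not at hlt
  have hne := (monic_paraOPUC μ n).ne_zero
  have hroot : (paraOPUC μ n).eval w = 0 := (rootMultiplicity_pos hne).1 (by omega)
  obtain ⟨S, hS⟩ := (le_rootMultiplicity_iff hne).1 hlt
  refine paraOPUC_ne_mul μ hμ (w := w) (w' := w) ?_ S (by rw [hS]; ring)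
  rw [Complex.mul_conj', norm_eq_one_of_paraOPUC_eval_eq_zero μ hμ hroot]
  simp

/-- Szegő quadrature: the moments of `μ` of order at most `n` are those of a positive measure
supported on the zeros of a para-orthogonal polynomial. -/
theorem exists_quadrature (μ : Measure Circle) [IsFiniteMeasure μ]
    (hμ : μ.support.Infinite) (n : ℕ) :
    ∃ (s : Finset Circle) (c : Circle → ℝ), (∀ z ∈ s, (paraOPUC μ n).eval (z : ℂ) = 0) ∧
      (∀ z, 0 ≤ c z) ∧ ∀ p q : ℂ[X], p.natDegree ≤ n → q.natDegree ≤ n →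
        opucInner μ p q = ∑ z ∈ s, c z * (p.eval (z : ℂ) * conj (q.eval (z : ℂ))) := by
  classical
  set N := paraOPUC μ n with hN
  have hne : N ≠ 0 := (monic_paraOPUC μ n).ne_zero
  set v : Circle → ℂ := fun z => z with hv
  have hinj : Function.Injective v := Circle.coe_injective
  set s : Finset Circle := N.roots.toFinset.preimage v hinj.injOn with hs
  have hmem : ∀ z, z ∈ s ↔ N.eval (z : ℂ) = 0 := fun z => by simp [hs, hne, hv]
  have himage : s.image v = N.roots.toFinset := by
    rw [hs, Finset.image_preimage, Finset.filter_true_of_mem]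
    intro w hw
    have h1 := norm_eq_one_of_paraOPUC_eval_eq_zero μ hμ (w := w) (n := n) (by
      simpa [hne, ← hN] using hw)
    exact ⟨⟨w, mem_sphere_zero_iff_norm.2 h1⟩, rfl⟩
  have hnodup := nodup_roots_paraOPUC μ hμ n
  have hcard : s.card = n + 1 := by
    rw [← Finset.card_image_of_injective s hinj, himage, Multiset.toFinset_card_of_nodup hnodup,
      (IsAlgClosed.splits N).natDegree_eq_card_roots.symm, natDegree_paraOPUC]
  have hnodal : Lagrange.nodal s v = N := by
    conv_rhs => rw [(IsAlgClosed.splits N).eq_prod_roots_of_monic (monic_paraOPUC μ n)]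
    rw [Lagrange.nodal, ← Finset.prod_image (f := fun w => X - C w) (g := v)
      (fun x _ y _ h => hinj h), himage, Finset.prod, Multiset.toFinset_val, hnodup.dedup]
  have hbasis : ∀ i ∈ s, Lagrange.basis s v i =
      C (Lagrange.nodalWeight s v i) * Lagrange.nodal (s.erase i) v := fun i hi => by
    rw [Lagrange.basis_eq_prod_sub_inv_mul_nodal_div hi, Lagrange.nodal_erase_eq_nodal_div hi]
  have horth : ∀ i ∈ s, ∀ j ∈ s, j ≠ i →
      opucInner μ (Lagrange.basis s v i) (Lagrange.basis s v j) = 0 := by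
    intro i hi j hj hij
    have hji : j ∈ s.erase i := Finset.mem_erase.2 ⟨hij, hj⟩
    have hij' : i ∈ s.erase j := Finset.mem_erase.2 ⟨hij.symm, hi⟩
    set S := Lagrange.nodal ((s.erase i).erase j) v with hS
    rw [hbasis i hi, hbasis j hj, opucInner_C_mul_left, opucInner_C_mul_right,
      Lagrange.nodal_eq_mul_nodal_erase hji, Lagrange.nodal_eq_mul_nodal_erase hij',
      Finset.erase_right_comm (a := j), ← hS]
    have hNS : N = (X - C (v i)) * ((X - C (v j)) * S) := by
      rw [← hnodal, Lagrange.nodal_eq_mul_nodal_erase hi, Lagrange.nodal_eq_mul_nodal_erase hji]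
    have hS0 : S ≠ 0 := Lagrange.nodal_ne_zero
    have h0 : opucInner μ N (X * S) = 0 := by
      refine opucInner_eq_zero_of_X_dvd μ (fun k => opucInner_paraOPUC_X_pow μ hμ) ?_ (by simp)
      rw [natDegree_X_mul hS0, hS, Lagrange.natDegree_nodal, Finset.card_erase_of_mem hji,
        Finset.card_erase_of_mem hi, hcard]
      have : 0 < (s.erase i).card := Finset.card_pos.2 ⟨j, hji⟩
      rw [Finset.card_erase_of_mem hi] at this
      omega
    -- For z and z_i on the circle, conj(z - z_i) = -conj(z_i) conj(z) (z - z_i), which restores the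
    -- factor missing from N.
    have h1 : opucInner μ ((X - C (v j)) * S) ((X - C (v i)) * S) =
        opucInner μ (C (-conj (v i)) * N) (X * S) := by
      refine opucInner_congr μ fun z => ?_
      rw [hNS]
      simp only [eval_mul, eval_sub, eval_X, eval_C, map_mul, map_sub]
      linear_combination ((z - v j) * S.eval (z : ℂ) * conj (S.eval (z : ℂ))) *
        (conj (v i) * circle_mul_conj z - conj (z : ℂ) * circle_mul_conj i)
    rw [h1, opucInner_C_mul_left, h0]
    simp
  have hrepr : ∀ p : ℂ[X], p.natDegree ≤ n →
      p = ∑ i ∈ s, C (p.eval (v i)) * Lagrange.basis s v i := by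
    intro p hp
    rw [← Lagrange.interpolate_apply]
    refine Lagrange.eq_interpolate hinj.injOn ?_
    rw [hcard]
    exact degree_le_natDegree.trans_lt (by exact_mod_cast Nat.lt_succ_of_le hp)
  -- The Lagrange basis at the n + 1 zeros is orthogonal, so the weights are its squared norms and
  -- positivity is automatic.
  refine ⟨s, fun z => ∫ x : Circle, ‖(Lagrange.basis s v z).eval (x : ℂ)‖ ^ 2 ∂μ,
    fun z hz => (hmem z).1 hz, fun z => integral_nonneg fun x => by positivity,
    fun p q hp hq => ?_⟩
  conv_lhs => rw [hrepr p hp, hrepr q hq]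
  rw [opucInner_sum_left]
  refine Finset.sum_congr rfl fun i hi => ?_
  rw [opucInner_sum_right, Finset.sum_eq_single i]
  · rw [opucInner_C_mul_left, opucInner_C_mul_right, opucInner_self]
    ring
  · intro j hj hji
    rw [opucInner_C_mul_left, opucInner_C_mul_right, horth i hi j hj hji]
    simp
  · exact fun h => absurd hi h

/-! ### Trigonometric form of the bounds -/

theorem abs_le_sqrt_sq_add {c q : ℝ} (hq : q ≤ 1) : |c| ≤ √(c ^ 2 + (1 - q)) :=
  Real.abs_le_sqrt (by linarith)

/-- Put s = √q and R = √(c² + 1 - q). Multiplied by 1 + s, the form C² - S² - 2cSC - s(C² + S²)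
factors as (C(R - c) - (1 + s)S)(C(R + c) + (1 + s)S), because R² - c² = (1 - s)(1 + s). The
hypothesis is the sign of the first factor; the second is nonnegative since R ≥ |c|. -/
theorem sqrt_le_of_upper {c q C S : ℝ} (hq0 : 0 ≤ q) (hq1 : q ≤ 1) (hCS : C ^ 2 + S ^ 2 = 1)
    (hC : 0 ≤ C) (hS : 0 ≤ S) (h : (1 + √q) * S ≤ C * (-c + √(c ^ 2 + (1 - q)))) :
    √q ≤ (C ^ 2 - S ^ 2) - c * (2 * S * C) := by
  have hs := Real.sqrt_nonneg q
  have hsq := Real.sq_sqrt hq0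
  have hRq := Real.sq_sqrt (by nlinarith [sq_nonneg c] : 0 ≤ c ^ 2 + (1 - q))
  have hR := (abs_le.1 (abs_le_sqrt_sq_add (c := c) hq1)).1
  set s := √q
  set R := √(c ^ 2 + (1 - q))
  have h1 : 0 ≤ (C * (-c + R) - (1 + s) * S) * ((c + R) * C + (1 + s) * S) := by
    refine mul_nonneg (by linarith) (add_nonneg (mul_nonneg (by linarith) hC) ?_)
    positivity
  have h2 : (C * (-c + R) - (1 + s) * S) * ((c + R) * C + (1 + s) * S) =
      (1 + s) * ((C ^ 2 - S ^ 2) - c * (2 * S * C) - s) := by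
    linear_combination C ^ 2 * hRq + C ^ 2 * hsq - (1 + s) * s * hCS
  rw [h2] at h1
  have := nonneg_of_mul_nonneg_right h1 (by linarith)
  linarith

/-- The substitution c ↦ -c, C ↔ S changes the sign of C² - S² - 2cSC. -/
theorem sqrt_le_of_lower {c q C S : ℝ} (hq0 : 0 ≤ q) (hq1 : q ≤ 1) (hCS : C ^ 2 + S ^ 2 = 1)
    (hC : 0 ≤ C) (hS : 0 ≤ S) (h : C * (1 + √q) ≤ S * (c + √(c ^ 2 + (1 - q)))) :
    √q ≤ -((C ^ 2 - S ^ 2) - c * (2 * S * C)) := by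
  have := sqrt_le_of_upper (c := -c) (C := S) (S := C) hq0 hq1 (by linarith) hS hC
    (by rw [neg_neg, neg_sq]; linarith)
  linarith

theorem cos_half_eq (θ : ℝ) :
    Real.cos (θ / 2) = Real.cos (θ / 4) ^ 2 - Real.sin (θ / 4) ^ 2 := by
  rw [← Real.cos_two_mul']; congr 1; ring

theorem sin_half_eq (θ : ℝ) :
    Real.sin (θ / 2) = 2 * Real.sin (θ / 4) * Real.cos (θ / 4) := by
  rw [← Real.sin_two_mul]; congr 1; ring

theorem sqrt_le_of_cot_le_lowerExpr {c q ϑ θ : ℝ} (hq0 : 0 ≤ q) (hq1 : q ≤ 1) (hϑ : 0 < ϑ)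
    (hϑθ : ϑ ≤ θ) (hθ : θ ≤ 2 * Real.pi) (h : Real.cot (ϑ / 4) ≤ lowerExpr c q) :
    √q ≤ -(Real.cos (θ / 2) - c * Real.sin (θ / 2)) := by
  have hpi := Real.pi_pos
  have hsϑ : 0 < Real.sin (ϑ / 4) := Real.sin_pos_of_pos_of_lt_pi (by linarith) (by linarith)
  have hss : Real.sin (ϑ / 4) ≤ Real.sin (θ / 4) :=
    Real.sin_le_sin_of_le_of_le_pi_div_two (by linarith) (by linarith) (by linarith)
  have hcc : Real.cos (θ / 4) ≤ Real.cos (ϑ / 4) :=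
    Real.cos_le_cos_of_nonneg_of_le_pi (by linarith) (by linarith) (by linarith)
  have hC : 0 ≤ Real.cos (θ / 4) := Real.cos_nonneg_of_mem_Icc ⟨by linarith, by linarith⟩
  have hs : 0 < 1 + √q := by positivity
  have hR := (abs_le.1 (abs_le_sqrt_sq_add (c := c) hq1)).1
  rw [cos_half_eq, sin_half_eq]
  refine sqrt_le_of_lower hq0 hq1 (Real.cos_sq_add_sin_sq _) hC (hsϑ.le.trans hss) ?_
  rw [Real.cot_eq_cos_div_sin, lowerExpr, div_le_div_iff₀ hsϑ hs] at h
  calc Real.cos (θ / 4) * (1 + √q) ≤ Real.cos (ϑ / 4) * (1 + √q) := by gcongr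
    _ ≤ (c + √(c ^ 2 + (1 - q))) * Real.sin (ϑ / 4) := h
    _ ≤ (c + √(c ^ 2 + (1 - q))) * Real.sin (θ / 4) :=
      mul_le_mul_of_nonneg_left hss (by linarith)
    _ = _ := mul_comm _ _

theorem sqrt_le_of_upperExpr_le_cotENN {c q ϑ θ : ℝ} (hq0 : 0 ≤ q) (hq1 : q ≤ 1) (hθ : 0 < θ)
    (hϑθ : θ ≤ ϑ) (hϑ : ϑ < 2 * Real.pi) (h : upperExpr c q ≤ cotENN (ϑ / 4)) :
    √q ≤ Real.cos (θ / 2) - c * Real.sin (θ / 2) := by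
  have hpi := Real.pi_pos
  have hsθ : 0 < Real.sin (θ / 4) := Real.sin_pos_of_pos_of_lt_pi (by linarith) (by linarith)
  have hss : Real.sin (θ / 4) ≤ Real.sin (ϑ / 4) :=
    Real.sin_le_sin_of_le_of_le_pi_div_two (by linarith) (by linarith) (by linarith)
  have hcc : Real.cos (ϑ / 4) ≤ Real.cos (θ / 4) :=
    Real.cos_le_cos_of_nonneg_of_le_pi (by linarith) (by linarith) (by linarith)
  have hCϑ : 0 < Real.cos (ϑ / 4) := Real.cos_pos_of_mem_Ioo ⟨by linarith, by linarith⟩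
  have hs : 0 < 1 + √q := by positivity
  have hR := (abs_le.1 (abs_le_sqrt_sq_add (c := c) hq1)).2
  have hsϑ := hsθ.trans_le hss
  rw [cos_half_eq, sin_half_eq]
  refine sqrt_le_of_upper hq0 hq1 (Real.cos_sq_add_sin_sq _) (hCϑ.le.trans hcc) hsθ.le ?_
  rw [upperExpr, cotENN, ← ENNReal.ofReal_div_of_pos hsϑ] at h
  -- Here ϑ > 0, so the cotangent is finite and the infinite value of the quotient is impossible.
  have hD : 0 < -c + √(c ^ 2 + (1 - q)) := by
    by_contra hD
    rw [ENNReal.ofReal_of_nonpos (not_lt.1 hD), ENNReal.div_zero (by simpa using hs)] at h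
    exact ENNReal.ofReal_ne_top (top_le_iff.1 h)
  rw [← ENNReal.ofReal_div_of_pos hD, ENNReal.ofReal_le_ofReal_iff (by positivity),
    div_le_div_iff₀ hD hsϑ] at h
  calc (1 + √q) * Real.sin (θ / 4) ≤ (1 + √q) * Real.sin (ϑ / 4) := by gcongr
    _ ≤ Real.cos (ϑ / 4) * (-c + √(c ^ 2 + (1 - q))) := h
    _ ≤ _ := by gcongr

/-! ### Localization of the measure -/

/-- The circle `ℝ / ℤ` is homeomorphic to the unit circle. -/
def unitAddCircleHomeo : AddCircle (1 : ℝ) ≃ₜ Circle := AddCircle.homeomorphCircle one_ne_zero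

theorem fourier_unitAddCircleHomeo_symm (k : ℤ) (z : Circle) :
    fourier k (unitAddCircleHomeo.symm z) = (z : ℂ) ^ k := by
  obtain ⟨x, rfl⟩ := unitAddCircleHomeo.surjective z
  rw [Homeomorph.symm_apply_apply, fourier_apply, AddCircle.toCircle_zsmul,
    unitAddCircleHomeo, AddCircle.homeomorphCircle_apply, Circle.coe_zpow]

theorem exists_fourier_approx (f : C(Circle, ℂ)) {ε : ℝ} (hε : 0 < ε) :
    ∃ g ∈ Submodule.span ℂ (Set.range (fourier (T := (1 : ℝ)))),
      ∀ z, ‖f z - g (unitAddCircleHomeo.symm z)‖ < ε := by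
  set F : C(AddCircle (1 : ℝ), ℂ) := f.comp ⟨unitAddCircleHomeo, unitAddCircleHomeo.continuous⟩
  have hF : F ∈ (Submodule.span ℂ (Set.range (fourier (T := (1 : ℝ))))).topologicalClosure := by
    rw [span_fourier_closure_eq_top]; trivial
  obtain ⟨g, hg, hFg⟩ := Metric.mem_closure_iff.1 hF ε hε
  refine ⟨g, hg, fun z => ?_⟩
  rw [dist_eq_norm] at hFg
  refine lt_of_le_of_lt ?_ hFg
  simpa [F] using (F - g).norm_coe_le_norm (unitAddCircleHomeo.symm z)

/-- The characters z^m and z^{-m} integrate to the moments ⟨z^m, 1⟩ and ⟨1, z^m⟩. The order n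
depends only on g and not on the quadrature, so the quadrature may be chosen afterwards. -/
theorem integral_eq_sum_of_quadrature (μ : Measure Circle) [IsFiniteMeasure μ]
    {g : C(AddCircle (1 : ℝ), ℂ)}
    (hg : g ∈ Submodule.span ℂ (Set.range (fourier (T := (1 : ℝ))))) :
    ∃ n : ℕ, ∀ (s : Finset Circle) (c : Circle → ℝ), (∀ p q : ℂ[X], p.natDegree ≤ n →
      q.natDegree ≤ n → opucInner μ p q =
        ∑ z ∈ s, c z * (p.eval (z : ℂ) * conj (q.eval (z : ℂ)))) →
      ∫ z, g (unitAddCircleHomeo.symm z) ∂μ = ∑ z ∈ s, c z * g (unitAddCircleHomeo.symm z) := by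
  have hint : ∀ g : C(AddCircle (1 : ℝ), ℂ),
      Integrable (fun z => g (unitAddCircleHomeo.symm z)) μ := fun g =>
    (g.continuous.comp unitAddCircleHomeo.symm.continuous).integrable_of_hasCompactSupport
      (HasCompactSupport.of_compactSpace _)
  induction hg using Submodule.span_induction with
  | mem g hg =>
    obtain ⟨k, rfl⟩ := hg
    obtain ⟨m, rfl | rfl⟩ := k.eq_nat_or_neg
    · refine ⟨m, fun s c h => ?_⟩
      have := h (X ^ m) 1 (natDegree_X_pow_le _) (by simp)
      simp only [fourier_unitAddCircleHomeo_symm, zpow_natCast]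
      simpa [opucInner] using this
    · refine ⟨m, fun s c h => ?_⟩
      have := h 1 (X ^ m) (by simp) (natDegree_X_pow_le _)
      have hz : ∀ z : Circle, (z : ℂ) ^ (-(m : ℤ)) = conj (z : ℂ) ^ m := fun z => by
        rw [zpow_neg, zpow_natCast, ← inv_pow, inv_eq_of_mul_eq_one_right (circle_mul_conj z)]
      simp only [fourier_unitAddCircleHomeo_symm, hz]
      simpa [opucInner] using this
  | zero => exact ⟨0, fun s c h => by simp⟩
  | add g₁ g₂ _ _ ih₁ ih₂ =>
    obtain ⟨n₁, h₁⟩ := ih₁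
    obtain ⟨n₂, h₂⟩ := ih₂
    refine ⟨max n₁ n₂, fun s c h => ?_⟩
    simp only [ContinuousMap.add_apply, mul_add, Finset.sum_add_distrib]
    rw [integral_add (hint g₁) (hint g₂),
      h₁ s c fun p q hp hq => h p q (le_max_of_le_left hp) (le_max_of_le_left hq),
      h₂ s c fun p q hp hq => h p q (le_max_of_le_right hp) (le_max_of_le_right hq)]
  | smul a g _ ih =>
    obtain ⟨n, h'⟩ := ih
    refine ⟨n, fun s c h => ?_⟩
    simp only [ContinuousMap.smul_apply, smul_eq_mul]
    rw [integral_const_mul, h' s c h, Finset.mul_sum]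
    exact Finset.sum_congr rfl fun z _ => by ring

/-- A closed set containing the unimodular zeros of all para-orthogonal polynomials carries the
measure. -/
theorem measure_compl_eq_zero_of_paraOPUC (μ : Measure Circle) [IsFiniteMeasure μ]
    (hμ : μ.support.Infinite) {K : Set Circle} (hK : IsClosed K) (hne : K.Nonempty)
    (h : ∀ n, ∀ z : Circle, (paraOPUC μ n).eval (z : ℂ) = 0 → z ∈ K) : μ Kᶜ = 0 := by
  have hfc : Continuous fun z : Circle => Metric.infDist z K := Metric.continuous_infDist_pt K
  have hfint : Integrable (fun z : Circle => Metric.infDist z K) μ :=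
    hfc.integrable_of_hasCompactSupport (HasCompactSupport.of_compactSpace _)
  set f : C(Circle, ℂ) := ⟨fun z => (Metric.infDist z K : ℝ), Complex.continuous_ofReal.comp hfc⟩
    with hf
  set M := μ.real Set.univ with hM
  -- The distance f to K vanishes at the nodes, so an approximant g is smaller than ε there and its
  -- quadrature sum is at most εM. Replacing f by g in the integral costs another εM.
  have hbound : ∀ ε : ℝ, 0 < ε → ‖∫ z, f z ∂μ‖ ≤ ε * (2 * M) := by
    intro ε hε
    obtain ⟨g, hg, hfg⟩ := exists_fourier_approx f hε
    obtain ⟨n, hn⟩ := integral_eq_sum_of_quadrature μ hg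
    obtain ⟨s, c, hs, hc, hq⟩ := exists_quadrature μ hμ n
    have hgint : Integrable (fun z => g (unitAddCircleHomeo.symm z)) μ :=
      (g.continuous.comp unitAddCircleHomeo.symm.continuous).integrable_of_hasCompactSupport
        (HasCompactSupport.of_compactSpace _)
    have hcsum : ∑ z ∈ s, c z = M := by
      have := hq 1 1 (by simp) (by simp)
      simp only [opucInner, eval_one, map_one, mul_one, integral_const, Complex.real_smul] at this
      exact_mod_cast this.symm
    have h1 : ‖∫ z, g (unitAddCircleHomeo.symm z) ∂μ‖ ≤ ε * M := by
      rw [hn s c hq, ← hcsum, Finset.mul_sum]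
      refine (norm_sum_le _ _).trans (Finset.sum_le_sum fun z hz => ?_)
      have hfz : f z = 0 := by
        simp [hf, Metric.infDist_zero_of_mem (h n z (hs z hz))]
      have := hfg z
      rw [hfz, zero_sub, norm_neg] at this
      rw [norm_mul, Complex.norm_real, Real.norm_of_nonneg (hc z), mul_comm]
      exact mul_le_mul_of_nonneg_right this.le (hc z)
    have h2 : ‖∫ z, f z - g (unitAddCircleHomeo.symm z) ∂μ‖ ≤ ε * M :=
      norm_integral_le_of_norm_le_const (Filter.Eventually.of_forall fun z => (hfg z).le)
    have hfint' : Integrable (fun z => f z) μ := hfint.ofReal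
    rw [integral_sub hfint' hgint] at h2
    calc ‖∫ z, f z ∂μ‖ = ‖(∫ z, f z ∂μ - ∫ z, g (unitAddCircleHomeo.symm z) ∂μ) +
          ∫ z, g (unitAddCircleHomeo.symm z) ∂μ‖ := by rw [sub_add_cancel]
      _ ≤ ε * M + ε * M := (norm_add_le _ _).trans (add_le_add h2 h1)
      _ = _ := by ring
  have hzero : ∫ z, f z ∂μ = 0 := by
    rw [← norm_le_zero_iff]
    refine le_of_forall_pos_le_add fun δ hδ => ?_
    have hM0 : 0 ≤ M := measureReal_nonneg
    refine (hbound (δ / (2 * M + 1)) (by positivity)).trans ?_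
    rw [zero_add, div_mul_eq_mul_div, div_le_iff₀ (by positivity)]
    nlinarith
  have hzero' : ∫ z, Metric.infDist z K ∂μ = 0 := by
    have : ∫ z, f z ∂μ = ((∫ z, Metric.infDist z K ∂μ : ℝ) : ℂ) := integral_complex_ofReal
    rw [this] at hzero
    exact_mod_cast hzero
  rw [integral_eq_zero_iff_of_nonneg (fun z => Metric.infDist_nonneg) hfint] at hzero'
  rw [← mem_ae_iff]
  filter_upwards [hzero'] with z hz
  by_contra hzK
  exact ((hK.notMem_iff_infDist_pos hne).1 hzK).ne' hz

theorem paraOPUC_eval_ne_zero (μ : Measure Circle) [IsFiniteMeasure μ]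
    (hμ : μ.support.Infinite) {θ : ℝ} (hθ : Circle.exp θ ≠ 1) {n : ℕ}
    (h : threeTerm (fun n => Real.cos (θ / 2) - cSeq (verblunsky μ) n * Real.sin (θ / 2))
        (dSeq (verblunsky μ)) n ≠ 0) : (paraOPUC μ n).eval (Circle.exp θ : ℂ) ≠ 0 := by
  rw [paraOPUC_eval_eq μ hμ]
  refine mul_ne_zero (mul_ne_zero (sub_ne_zero.2 fun h => hθ (Circle.ext h)) ?_)
    (by exact_mod_cast h)
  refine mul_ne_zero (pow_ne_zero _ (Circle.coe_ne_zero _)) (Finset.prod_ne_zero_iff.2 ?_)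
  intro k _
  have hr := re_one_sub_tauSeq_mul_pos (norm_verblunsky_lt_one μ hμ) k
  refine div_ne_zero (by exact_mod_cast hr.ne') fun h0 => ?_
  have := congrArg Complex.re h0
  simp only [Complex.sub_re, Complex.one_re, Complex.zero_re] at this
  exact hr.ne' this

end

theorem mainTheorem8 (μ : Measure Circle) [IsFiniteMeasure μ] (hμ : μ.support.Infinite)
    (q : ℕ → ℝ) (hq : IsScalingSeq q (dSeq (verblunsky μ)))
    (ϑ₁ ϑ₂ : ℝ) (h₁ : 0 ≤ ϑ₁) (h₁₂ : ϑ₁ < ϑ₂) (h₂ : ϑ₂ ≤ 2 * Real.pi)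
    (hlower : ∀ n : ℕ, 1 ≤ n →
      Real.cot (ϑ₂ / 4) ≤ lowerExpr (cSeq (verblunsky μ) n) (qOne q n))
    (hupper : ∀ n : ℕ, 1 ≤ n →
      upperExpr (cSeq (verblunsky μ) n) (qOne q n) ≤ cotENN (ϑ₁ / 4)) :
    (massFamily μ 0).support ⊆ closedArc ϑ₁ ϑ₂ := by
  have harc : IsClosed (closedArc ϑ₁ ϑ₂) :=
    (isCompact_Icc.image Circle.exp.continuous).isClosed
  -- The point 1 must be adjoined, since it is a zero of every N_n.
  have hK : μ (closedArc ϑ₁ ϑ₂ ∪ {1})ᶜ = 0 := by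
    refine measure_compl_eq_zero_of_paraOPUC μ hμ (harc.union isClosed_singleton)
      ⟨1, Or.inr rfl⟩ fun n z hz => ?_
    by_contra hzK
    simp only [Set.mem_union, Set.mem_singleton_iff, not_or] at hzK
    obtain ⟨θ, ⟨hθ0, hθ2⟩, rfl⟩ : ∃ θ ∈ Set.Ico 0 (2 * Real.pi), Circle.exp θ = z := by
      obtain ⟨x, rfl⟩ := Circle.exp_surjective z
      obtain ⟨y, hy, hxy⟩ := Circle.periodic_exp.exists_mem_Ico₀ Real.two_pi_pos x
      exact ⟨y, hy, hxy.symm⟩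
    have hθpos : 0 < θ := lt_of_le_of_ne hθ0 fun h => hzK.2 (by simp [← h])
    refine paraOPUC_eval_ne_zero μ hμ hzK.2 ?_ hz
    rcases lt_or_ge θ ϑ₁ with hlt | hge
    · exact (threeTerm_pos hq (fun n hn => sqrt_le_of_upperExpr_le_cotENN (qOne_pos hq hn).le
        (qOne_le_one hq hn) hθpos hlt.le (h₁₂.trans_le h₂) (hupper n hn)) n).ne'
    · have hgt : ϑ₂ < θ := not_le.1 fun h => hzK.1 ⟨θ, ⟨hge, h⟩, rfl⟩
      -- Beyond ϑ₂ the coefficients a_n are negative; negating them only multiplies W_n by (-1)^n.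
      have hpos := threeTerm_pos hq (a := -fun n => Real.cos (θ / 2) -
        cSeq (verblunsky μ) n * Real.sin (θ / 2)) (fun n hn =>
          sqrt_le_of_cot_le_lowerExpr (qOne_pos hq hn).le (qOne_le_one hq hn)
            (h₁.trans_lt h₁₂) hgt.le hθ2.le (hlower n hn)) n
      rw [threeTerm_neg] at hpos
      exact right_ne_zero_of_mul hpos.ne'
  refine Measure.support_subset_of_isClosed harc ?_
  rw [mem_ae_iff]
  -- Conditioning on the complement of 1 discards exactly the adjoined point.
  have hcond : ProbabilityTheory.cond μ {1}ᶜ (closedArc ϑ₁ ϑ₂)ᶜ = 0 := by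
    rw [ProbabilityTheory.cond_apply (measurableSet_singleton _).compl, ← Set.compl_union,
      Set.union_comm, hK, mul_zero]
  simp [massFamily, hcond]
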